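/- Let $(M,\langle\cdot,\cdot\rangle)$ be a smooth $m$-dimensional Lorentzian manifold (signature $(-,+,\dots,+)$) with Levi-Civita connection $\nabla$, and let $\mathcal K_t,\mathcal K_\varphi$ be two commuting Killing vector fields on $M$ with $\det(\langle \mathcal K_\alpha,\mathcal K_\beta\rangle)_{\alpha,\beta\in\{t,\varphi\}}<0$ everywhere on $M$. For a constant $\rho\in\mathbb R$ put $\hat\rho=\rho\,\mathcal K_t+\mathcal K_\varphi$, and suppose that $\nabla_{\hat\rho}\hat\rho\neq0$ at every point where $\langle\hat\rho,\hat\rho\rangle=0$. Put $\mathcal N=\nabla_{\hat\rho}\hat\rho$. Then: (i) the function $\langle\hat\rho,\hat\rho\rangle$ is smooth and, on all of $M$, $\nabla\langle\hat\rho,\hat\rho\rangle=-2\mathcal N$ and $\langle\mathcal N,\hat\rho\rangle=0$; (ii) $\mathcal C=\{p\in M:\langle\hat\rho,\hat\rho\rangle\ge0\}$ is a smoothly embedded $m$-dimensional submanifold with boundary of $M$, whose manifold interior is $\mathcal O=\{\langle\hat\rho,\hat\rho\rangle>0\}$ and whose manifold boundary is $\partial\mathcal C=\{\langle\hat\rho,\hat\rho\rangle=0\}$;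 (iii) $\partial\mathcal C$ is a smoothly embedded $(m-1)$-dimensional submanifold of $M$, and on it $\mathcal N$ is an outward normal of $\mathcal C$: at each point of $\partial\mathcal C$ the vector $\mathcal N$ is orthogonal to all vectors tangent to $\partial\mathcal C$, it points strictly out of $\mathcal C$, and the derivative of $\langle\hat\rho,\hat\rho\rangle$ in the direction $\mathcal N$ is strictly negative. (The sets $\mathcal C$, $\mathcal O$, $\partial\mathcal C$ may be empty.) -/

import Mathlib

open scoped Manifold ContDiff Bundle Topology

/-- The vector field `X` is differentiable at `x`. -/
abbrev MDiffFieldAt {m : ℕ} {M : Type*} [TopologicalSpace M]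
    [ChartedSpace (EuclideanSpace ℝ (Fin m)) M] [IsManifold (𝓡 m) ∞ M]
    (X : Π x : M, TangentSpace (𝓡 m) x) (x : M) : Prop :=
  MDifferentiableAt (𝓡 m) (𝓡 m).tangent
    (fun y ↦ Bundle.TotalSpace.mk' (EuclideanSpace ℝ (Fin m)) y (X y)) x

/-- A smooth Lorentzian metric, of signature `(-, +, ..., +)`, on an `m`-dimensional manifold. -/
structure LorentzianMetric (m : ℕ) (M : Type*) [TopologicalSpace M]
    [ChartedSpace (EuclideanSpace ℝ (Fin m)) M] [IsManifold (𝓡 m) ∞ M] where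
  /-- The scalar product on each tangent space. -/
  inner (x : M) : TangentSpace (𝓡 m) x →L[ℝ] TangentSpace (𝓡 m) x →L[ℝ] ℝ
  symm (x : M) (v w : TangentSpace (𝓡 m) x) : inner x v w = inner x w v
  /-- There is a timelike direction whose orthogonal complement is spacelike, that is, the
  scalar product is nondegenerate of index one. -/
  lorentzian (x : M) : ∃ u : TangentSpace (𝓡 m) x, inner x u u < 0 ∧
    ∀ v : TangentSpace (𝓡 m) x, inner x u v = 0 → v ≠ 0 → 0 < inner x v v
  contMDiff : ContMDiff (𝓡 m)
    ((𝓡 m).prod 𝓘(ℝ, EuclideanSpace ℝ (Fin m) →L[ℝ] EuclideanSpace ℝ (Fin m) →L[ℝ] ℝ)) ∞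
    (fun x ↦ Bundle.TotalSpace.mk'
      (EuclideanSpace ℝ (Fin m) →L[ℝ] EuclideanSpace ℝ (Fin m) →L[ℝ] ℝ) x (inner x))

namespace LorentzianMetric

variable {m : ℕ} {M : Type*} [TopologicalSpace M]
  [ChartedSpace (EuclideanSpace ℝ (Fin m)) M] [IsManifold (𝓡 m) ∞ M]

theorem eq_zero_of_inner_eq_zero (g : LorentzianMetric m M) {x : M} {v : TangentSpace (𝓡 m) x}
    (h : ∀ w, g.inner x v w = 0) : v = 0 := by
  by_contra hv
  obtain ⟨u, -, hu⟩ := g.lorentzian x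
  have h1 := hu v (by rw [g.symm, h]) hv
  rw [h v] at h1
  exact lt_irrefl _ h1

/-- The metric isomorphism `v ↦ ⟨v, ·⟩` from the tangent space to its dual. -/
noncomputable def flat (g : LorentzianMetric m M) (x : M) :
    TangentSpace (𝓡 m) x ≃ₗ[ℝ] (TangentSpace (𝓡 m) x →L[ℝ] ℝ) :=
  haveI : FiniteDimensional ℝ (TangentSpace (𝓡 m) x) :=
    inferInstanceAs (FiniteDimensional ℝ (EuclideanSpace ℝ (Fin m)))
  haveI : T2Space (TangentSpace (𝓡 m) x) :=
    inferInstanceAs (T2Space (EuclideanSpace ℝ (Fin m)))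
  haveI : FiniteDimensional ℝ (TangentSpace (𝓡 m) x →L[ℝ] ℝ) :=
    Module.Finite.equiv
      (LinearMap.toContinuousLinearMap (𝕜 := ℝ) (E := TangentSpace (𝓡 m) x) (F' := ℝ))
  LinearEquiv.ofInjectiveOfFinrankEq (g.inner x).toLinearMap
    (by
      refine (injective_iff_map_eq_zero _).2 fun v hv ↦ g.eq_zero_of_inner_eq_zero fun w ↦ ?_
      exact congrArg (fun l : TangentSpace (𝓡 m) x →L[ℝ] ℝ ↦ l w) hv)
    (by
      rw [← (LinearMap.toContinuousLinearMap (𝕜 := ℝ) (E := TangentSpace (𝓡 m) x)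
        (F' := ℝ)).finrank_eq]
      exact Subspace.dual_finrank_eq.symm)

theorem flat_apply (g : LorentzianMetric m M) (x : M) (v : TangentSpace (𝓡 m) x) :
    g.flat x v = g.inner x v := rfl

theorem inner_flat_symm (g : LorentzianMetric m M) (x : M) (l : TangentSpace (𝓡 m) x →L[ℝ] ℝ)
    (w : TangentSpace (𝓡 m) x) : g.inner x ((g.flat x).symm l) w = l w := by
  rw [← flat_apply, LinearEquiv.apply_symm_apply]

/-- The gradient of a function: `⟨∇f, w⟩ = df(w)` for all tangent vectors `w`. -/
noncomputable def gradient (g : LorentzianMetric m M) (f : M → ℝ) (x : M) :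
    TangentSpace (𝓡 m) x :=
  (g.flat x).symm (mvfderiv (𝓡 m) f x)

theorem mdifferentiableAt_inner (g : LorentzianMetric m M)
    {X Y : Π x : M, TangentSpace (𝓡 m) x} {x : M}
    (hX : MDiffFieldAt X x) (hY : MDiffFieldAt Y x) :
    MDifferentiableAt (𝓡 m) 𝓘(ℝ) (fun y ↦ g.inner y (X y) (Y y)) x := by
  have : MDifferentiableAt (𝓡 m) ((𝓡 m).prod 𝓘(ℝ))
      (fun y ↦ Bundle.TotalSpace.mk' ℝ (E := Bundle.Trivial M ℝ) y (g.inner y (X y) (Y y))) x := by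
    apply MDifferentiableAt.clm_bundle_apply₂ (F₁ := EuclideanSpace ℝ (Fin m))
      (F₂ := EuclideanSpace ℝ (Fin m))
    · exact g.contMDiff.mdifferentiableAt (by simp)
    · exact hX
    · exact hY
  simp only [mdifferentiableAt_totalSpace] at this
  exact this.2

/-- A connection on the tangent bundle is the Levi-Civita connection of `g` if it is torsion free
and compatible with the metric. Here `D Y x (X x)` stands for `(∇_X Y)(x)`. -/
structure IsLeviCivita (g : LorentzianMetric m M)
    (D : CovariantDerivative (𝓡 m) (EuclideanSpace ℝ (Fin m))
      (TangentSpace (𝓡 m) : M → Type _)) : Prop where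
  torsion_free : ∀ (X Y : Π x : M, TangentSpace (𝓡 m) x) (x : M),
    MDiffFieldAt X x → MDiffFieldAt Y x →
      D Y x (X x) - D X x (Y x) = VectorField.mlieBracket (𝓡 m) X Y x
  metric_compatible : ∀ (X Y : Π x : M, TangentSpace (𝓡 m) x) (x : M) (v : TangentSpace (𝓡 m) x),
    MDiffFieldAt X x → MDiffFieldAt Y x →
      (mvfderiv (𝓡 m) (fun y ↦ g.inner y (X y) (Y y)) x) v
        = g.inner x (D X x v) (Y x) + g.inner x (X x) (D Y x v)

/-- The right-hand side of the Koszul formula for `2 ⟨∇_X Y, Z⟩`. -/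
noncomputable def koszul (g : LorentzianMetric m M) (Y X Z : Π x : M, TangentSpace (𝓡 m) x)
    (x : M) : ℝ :=
  (mvfderiv (𝓡 m) (fun y ↦ g.inner y (Y y) (Z y)) x) (X x) + (mvfderiv (𝓡 m) (fun y ↦ g.inner y (X y) (Z y)) x) (Y x)
    - (mvfderiv (𝓡 m) (fun y ↦ g.inner y (X y) (Y y)) x) (Z x)
    + g.inner x (VectorField.mlieBracket (𝓡 m) X Y x) (Z x)
    - g.inner x (VectorField.mlieBracket (𝓡 m) X Z x) (Y x)
    - g.inner x (VectorField.mlieBracket (𝓡 m) Y Z x) (X x)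

section Koszul

variable (g : LorentzianMetric m M) {X X₁ Y Y₁ Z Z₁ : Π x : M, TangentSpace (𝓡 m) x} {x : M}

theorem mvfderiv_inner_add_left (hX : MDiffFieldAt X x) (hX₁ : MDiffFieldAt X₁ x)
    (hZ : MDiffFieldAt Z x) :
    mvfderiv (𝓡 m) (fun y ↦ g.inner y ((X + X₁) y) (Z y)) x
      = mvfderiv (𝓡 m) (fun y ↦ g.inner y (X y) (Z y)) x + mvfderiv (𝓡 m) (fun y ↦ g.inner y (X₁ y) (Z y)) x := by
  rw [← mvfderiv_add (g.mdifferentiableAt_inner hX hZ) (g.mdifferentiableAt_inner hX₁ hZ)]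
  congr 1
  funext y
  simp

theorem mvfderiv_inner_smul_left {f : M → ℝ} (hf : MDifferentiableAt (𝓡 m) 𝓘(ℝ) f x) (hX : MDiffFieldAt X x)
    (hZ : MDiffFieldAt Z x) :
    mvfderiv (𝓡 m) (fun y ↦ g.inner y ((f • X) y) (Z y)) x
      = f x • mvfderiv (𝓡 m) (fun y ↦ g.inner y (X y) (Z y)) x + g.inner x (X x) (Z x) • mvfderiv (𝓡 m) f x := by
  rw [← mvfderiv_mul hf (g.mdifferentiableAt_inner hX hZ)]
  congr 1
  funext y
  simp

theorem mvfderiv_inner_comm :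
    mvfderiv (𝓡 m) (fun y ↦ g.inner y (X y) (Z y)) x = mvfderiv (𝓡 m) (fun y ↦ g.inner y (Z y) (X y)) x := by
  congr 1
  funext y
  exact g.symm y _ _

theorem mvfderiv_inner_add_right (hX : MDiffFieldAt X x) (hX₁ : MDiffFieldAt X₁ x)
    (hZ : MDiffFieldAt Z x) :
    mvfderiv (𝓡 m) (fun y ↦ g.inner y (Z y) ((X + X₁) y)) x
      = mvfderiv (𝓡 m) (fun y ↦ g.inner y (Z y) (X y)) x + mvfderiv (𝓡 m) (fun y ↦ g.inner y (Z y) (X₁ y)) x := by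
  rw [g.mvfderiv_inner_comm (X := Z) (Z := X + X₁), g.mvfderiv_inner_add_left hX hX₁ hZ,
    g.mvfderiv_inner_comm (X := X), g.mvfderiv_inner_comm (X := X₁)]

theorem mvfderiv_inner_smul_right {f : M → ℝ} (hf : MDifferentiableAt (𝓡 m) 𝓘(ℝ) f x) (hX : MDiffFieldAt X x)
    (hZ : MDiffFieldAt Z x) :
    mvfderiv (𝓡 m) (fun y ↦ g.inner y (Z y) ((f • X) y)) x
      = f x • mvfderiv (𝓡 m) (fun y ↦ g.inner y (Z y) (X y)) x + g.inner x (Z x) (X x) • mvfderiv (𝓡 m) f x := by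
  rw [g.mvfderiv_inner_comm (X := Z) (Z := f • X), g.mvfderiv_inner_smul_left hf hX hZ,
    g.mvfderiv_inner_comm (X := X), g.symm]

theorem koszul_tensorial_left (hY : MDiffFieldAt Y x) (hZ : MDiffFieldAt Z x) :
    TensorialAt (𝓡 m) (EuclideanSpace ℝ (Fin m)) (fun X ↦ g.koszul Y X Z x) x where
  smul {f X} hf hX := by
    simp only [koszul, g.mvfderiv_inner_smul_left hf hX hZ, g.mvfderiv_inner_smul_left hf hX hY,
      VectorField.mlieBracket_smul_left hf hX]
    simp
    ring
  add {X X'} hX hX' := by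
    simp only [koszul, g.mvfderiv_inner_add_left hX hX' hZ, g.mvfderiv_inner_add_left hX hX' hY,
      VectorField.mlieBracket_add_left hX hX']
    simp
    ring

theorem koszul_tensorial_right (hX : MDiffFieldAt X x) (hY : MDiffFieldAt Y x) :
    TensorialAt (𝓡 m) (EuclideanSpace ℝ (Fin m)) (fun Z ↦ g.koszul Y X Z x) x where
  smul {f Z} hf hZ := by
    simp only [koszul, g.mvfderiv_inner_smul_right hf hZ hX,
      g.mvfderiv_inner_smul_right hf hZ hY, VectorField.mlieBracket_smul_right hf hZ]
    simp [g.symm x (Z x)]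
    ring
  add {Z Z'} hZ hZ' := by
    simp only [koszul, g.mvfderiv_inner_add_right hZ hZ' hX,
      g.mvfderiv_inner_add_right hZ hZ' hY, VectorField.mlieBracket_add_right hZ hZ']
    simp
    ring

theorem koszul_add (hX : MDiffFieldAt X x) (hZ : MDiffFieldAt Z x) (hY : MDiffFieldAt Y x)
    (hY₁ : MDiffFieldAt Y₁ x) :
    g.koszul (Y + Y₁) X Z x = g.koszul Y X Z x + g.koszul Y₁ X Z x := by
  simp only [koszul, g.mvfderiv_inner_add_left hY hY₁ hZ,
    g.mvfderiv_inner_add_right hY hY₁ hX, VectorField.mlieBracket_add_left hY hY₁,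
    VectorField.mlieBracket_add_right hY hY₁]
  simp
  ring

theorem koszul_smul {f : M → ℝ} (hf : MDifferentiableAt (𝓡 m) 𝓘(ℝ) f x) (hX : MDiffFieldAt X x)
    (hZ : MDiffFieldAt Z x) (hY : MDiffFieldAt Y x) :
    g.koszul (f • Y) X Z x
      = f x * g.koszul Y X Z x + 2 * mvfderiv (𝓡 m) f x (X x) * g.inner x (Y x) (Z x) := by
  simp only [koszul, g.mvfderiv_inner_smul_left hf hY hZ,
    g.mvfderiv_inner_smul_right hf hY hX, VectorField.mlieBracket_smul_left hf hY,
    VectorField.mlieBracket_smul_right hf hY]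
  simp [g.symm x (Y x) (X x)]
  ring

theorem koszul_sub_koszul :
    g.koszul Y X Z x - g.koszul X Y Z x
      = 2 * g.inner x (VectorField.mlieBracket (𝓡 m) X Y x) (Z x) := by
  simp only [koszul, g.mvfderiv_inner_comm (X := Y) (Z := X),
    VectorField.mlieBracket_swap_apply (V := Y) (W := X)]
  simp
  ring

theorem koszul_add_koszul :
    g.koszul Y X Z x + g.koszul Z X Y x
      = 2 * mvfderiv (𝓡 m) (fun y ↦ g.inner y (Y y) (Z y)) x (X x) := by
  simp only [koszul, g.mvfderiv_inner_comm (X := Z) (Z := Y),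
    VectorField.mlieBracket_swap_apply (V := Z) (W := Y)]
  simp
  ring

/-- Half of the Koszul expression as a bilinear form in `X` and `Z`. -/
noncomputable def koszulForm (hY : MDiffFieldAt Y x) :
    TangentSpace (𝓡 m) x →L[ℝ] TangentSpace (𝓡 m) x →L[ℝ] ℝ :=
  (2⁻¹ : ℝ) • TensorialAt.mkHom₂ (fun X Z ↦ g.koszul Y X Z x) x
    (fun _ hZ ↦ g.koszul_tensorial_left hY hZ) (fun _ hX ↦ g.koszul_tensorial_right hX hY)

theorem koszulForm_apply (hX : MDiffFieldAt X x) (hY : MDiffFieldAt Y x)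
    (hZ : MDiffFieldAt Z x) :
    g.koszulForm hY (X x) (Z x) = 2⁻¹ * g.koszul Y X Z x := by
  simp only [koszulForm, smul_apply, smul_eq_mul]
  rw [TensorialAt.mkHom₂_apply _ _ hX hZ]

open Classical in
/-- The covariant derivative given by the Koszul formula. -/
noncomputable def koszulDeriv (Y : Π x : M, TangentSpace (𝓡 m) x) (x : M) :
    TangentSpace (𝓡 m) x →L[ℝ] TangentSpace (𝓡 m) x :=
  haveI : FiniteDimensional ℝ (TangentSpace (𝓡 m) x) :=
    inferInstanceAs (FiniteDimensional ℝ (EuclideanSpace ℝ (Fin m)))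
  haveI : T2Space (TangentSpace (𝓡 m) x) :=
    inferInstanceAs (T2Space (EuclideanSpace ℝ (Fin m)))
  if hY : MDiffFieldAt Y x then
    LinearMap.toContinuousLinearMap
      ((g.flat x).symm.toLinearMap.comp (g.koszulForm hY).toLinearMap)
  else 0

theorem inner_koszulDeriv (hX : MDiffFieldAt X x) (hY : MDiffFieldAt Y x)
    (hZ : MDiffFieldAt Z x) :
    g.inner x (g.koszulDeriv Y x (X x)) (Z x) = 2⁻¹ * g.koszul Y X Z x := by
  rw [← g.koszulForm_apply hX hY hZ, koszulDeriv, dif_pos hY]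
  exact g.inner_flat_symm x _ _

theorem ext_inner {v w : TangentSpace (𝓡 m) x}
    (h : ∀ Z : Π x : M, TangentSpace (𝓡 m) x, MDiffFieldAt Z x →
      g.inner x v (Z x) = g.inner x w (Z x)) : v = w := by
  refine sub_eq_zero.1 (g.eq_zero_of_inner_eq_zero fun z ↦ ?_)
  have := h (FiberBundle.extend (EuclideanSpace ℝ (Fin m)) z)
    (FiberBundle.mdifferentiableAt_extend ..)
  simp only [FiberBundle.extend_apply_self] at this
  simp [this]

end Koszul

/-- Every Lorentzian metric has a Levi-Civita connection. -/
theorem exists_isLeviCivita (g : LorentzianMetric m M) :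
    ∃ D : CovariantDerivative (𝓡 m) (EuclideanSpace ℝ (Fin m))
      (TangentSpace (𝓡 m) : M → Type _), g.IsLeviCivita D := by
  refine ⟨⟨g.koszulDeriv, ⟨?_, ?_⟩⟩, ⟨?_, ?_⟩⟩
  · intro Y Y' x hY hY' _
    ext1 v
    obtain ⟨X, hX, rfl⟩ : ∃ X : Π x : M, TangentSpace (𝓡 m) x, MDiffFieldAt X x ∧ X x = v :=
      ⟨FiberBundle.extend (EuclideanSpace ℝ (Fin m)) v,
        FiberBundle.mdifferentiableAt_extend .., FiberBundle.extend_apply_self ..⟩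
    refine g.ext_inner fun Z hZ ↦ ?_
    rw [g.inner_koszulDeriv hX (mdifferentiableAt_add_section hY hY') hZ,
      g.koszul_add hX hZ hY hY']
    simp [g.inner_koszulDeriv hX hY hZ, g.inner_koszulDeriv hX hY' hZ]
    ring
  · intro Y f x hY hf _
    ext1 v
    obtain ⟨X, hX, rfl⟩ : ∃ X : Π x : M, TangentSpace (𝓡 m) x, MDiffFieldAt X x ∧ X x = v :=
      ⟨FiberBundle.extend (EuclideanSpace ℝ (Fin m)) v,
        FiberBundle.mdifferentiableAt_extend .., FiberBundle.extend_apply_self ..⟩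
    refine g.ext_inner fun Z hZ ↦ ?_
    rw [g.inner_koszulDeriv hX (hf.smul_section hY) hZ, g.koszul_smul hf hX hZ hY]
    simp [g.inner_koszulDeriv hX hY hZ]
    ring
  · intro X Y x hX hY
    refine g.ext_inner fun Z hZ ↦ ?_
    have h := g.koszul_sub_koszul (X := X) (Y := Y) (Z := Z) (x := x)
    have h1 := g.inner_koszulDeriv hX hY hZ
    have h2 := g.inner_koszulDeriv hY hX hZ
    simp only [map_sub, sub_apply]
    linear_combination h1 - h2 + h / 2
  · intro X Y x v hX hY
    obtain ⟨V, hV, rfl⟩ : ∃ V : Π x : M, TangentSpace (𝓡 m) x, MDiffFieldAt V x ∧ V x = v :=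
      ⟨FiberBundle.extend (EuclideanSpace ℝ (Fin m)) v,
        FiberBundle.mdifferentiableAt_extend .., FiberBundle.extend_apply_self ..⟩
    have h := g.koszul_add_koszul (X := V) (Y := X) (Z := Y) (x := x)
    have h1 := g.inner_koszulDeriv hV hX hY
    have h2 := g.inner_koszulDeriv hV hY hX
    rw [g.symm x (X x)]
    linear_combination -h1 - h2 - h / 2

/-- The Levi-Civita connection; `g.leviCivita Y x (X x)` stands for `(∇_X Y)(x)`. -/
noncomputable def leviCivita (g : LorentzianMetric m M) :
    CovariantDerivative (𝓡 m) (EuclideanSpace ℝ (Fin m)) (TangentSpace (𝓡 m) : M → Type _) :=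
  g.exists_isLeviCivita.choose

theorem isLeviCivita_leviCivita (g : LorentzianMetric m M) : g.IsLeviCivita g.leviCivita :=
  g.exists_isLeviCivita.choose_spec

/-- Killing vector fields: smooth fields `K` with vanishing Lie derivative `L_K g = 0`. -/
structure IsKilling (g : LorentzianMetric m M) (K : Π x : M, TangentSpace (𝓡 m) x) : Prop where
  contMDiff : ContMDiff (𝓡 m) (𝓡 m).tangent ∞
    (fun y ↦ Bundle.TotalSpace.mk' (EuclideanSpace ℝ (Fin m)) y (K y))
  lieDerivative_eq_zero : ∀ (X Y : Π x : M, TangentSpace (𝓡 m) x) (x : M),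
    MDiffFieldAt X x → MDiffFieldAt Y x →
      mvfderiv (𝓡 m) (fun y ↦ g.inner y (X y) (Y y)) x (K x)
        - g.inner x (VectorField.mlieBracket (𝓡 m) K X x) (Y x)
        - g.inner x (X x) (VectorField.mlieBracket (𝓡 m) K Y x) = 0

/-- The function `⟨X, X⟩`. -/
noncomputable def normSq (g : LorentzianMetric m M) (X : Π x : M, TangentSpace (𝓡 m) x)
    (x : M) : ℝ :=
  g.inner x (X x) (X x)

/-- The region `C` where `⟨X, X⟩ ≥ 0`. -/
def region (g : LorentzianMetric m M) (X : Π x : M, TangentSpace (𝓡 m) x) : Set M :=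
  {x | 0 ≤ g.normSq X x}

/-- The set where `⟨X, X⟩ = 0`. -/
def nullSet (g : LorentzianMetric m M) (X : Π x : M, TangentSpace (𝓡 m) x) : Set M :=
  {x | g.normSq X x = 0}

/-- The vector field `∇_X X`. -/
noncomputable def selfDeriv (g : LorentzianMetric m M) (X : Π x : M, TangentSpace (𝓡 m) x)
    (x : M) : TangentSpace (𝓡 m) x :=
  g.leviCivita X x (X x)

end LorentzianMetric

/-- The tangent vector `v` at `p` points out of `C`: every curve through `p` with velocity `v`
is in `C` just before it passes `p`, and out of `C` just after. For a domain `C` with smooth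
boundary and a boundary point `p`, this says that `v` lies in the open half-space of vectors
pointing strictly outwards. -/
def IsOutwardPointing {m : ℕ} {M : Type*} [TopologicalSpace M]
    [ChartedSpace (EuclideanSpace ℝ (Fin m)) M] (C : Set M) (p : M)
    (v : TangentSpace (𝓡 m) p) : Prop :=
  ∀ c : ℝ → M, ∀ h : c 0 = p,
    HasMFDerivAt 𝓘(ℝ) (𝓡 m) c 0
      ((1 : ℝ →L[ℝ] ℝ).smulRight (h ▸ v : TangentSpace (𝓡 m) (c 0))) →
    (∀ᶠ t in 𝓝[<] (0 : ℝ), c t ∈ C) ∧ ∀ᶠ t in 𝓝[>] (0 : ℝ), c t ∉ C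

/-- The vector field `ρ K_t + K_φ` with constant parameter `ρ`. -/
noncomputable def impactField {m : ℕ} {M : Type*} [TopologicalSpace M]
    [ChartedSpace (EuclideanSpace ℝ (Fin m)) M] (ρ : ℝ) (Kt Kφ : Π x : M, TangentSpace (𝓡 m) x) :
    Π x : M, TangentSpace (𝓡 m) x :=
  fun x ↦ ρ • Kt x + Kφ x

/-! Write F = ⟨R, R⟩ and N = ∇_R R. Since R is Killing, ∇R is skew, so metric compatibility gives dF
= -2⟨N, ·⟩, and skewness on the pair (R, R) gives N ⊥ R. The flow of K_t preserves both the metric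
and R, because [K_t, R] = 0; hence dF(K_t) = 0, that is N ⊥ K_t, and by linearity N ⊥ K_φ.

The negative determinant makes the span of K_t and K_φ a Lorentzian plane, whose orthogonal
complement is spacelike. Where F = 0, N is nonzero by hypothesis, so ⟨N, N⟩ > 0 and dF(N) = -2⟨N, N⟩
< 0. Nondegeneracy and N ≠ 0 would already make 0 a regular value; the sign, and so the outward
direction, needs N to be spacelike.

What remains is the regular value theorem, with and without boundary. By the inverse function
theorem F is a coordinate near each of its zeros (`exists_chart_coord_eq`), so {F = 0} is locally a
hyperplane and {F ≥ 0} a half-space. `exists_isSmoothEmbedding_of_slice` turns such charts into an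
embedded submanifold in both cases. -/

/-! ### Submanifolds from slice charts -/

section Slice

variable {E E' F H' M : Type*} [NormedAddCommGroup E] [NormedSpace ℝ E]
  [NormedAddCommGroup E'] [NormedSpace ℝ E'] [NormedAddCommGroup F] [NormedSpace ℝ F]
  [TopologicalSpace H'] [TopologicalSpace M]

/-- A chart of `M` in which the subset `S` is the image of the model `J`, followed by the linear
inclusion `x ↦ equiv (x, 0)`, restricts to a chart of `S`. -/
noncomputable def OpenPartialHomeomorph.slice (φ : OpenPartialHomeomorph M E)
    (J : ModelWithCorners ℝ E' H') (equiv : (E' × F) ≃L[ℝ] E) {S : Set M} (p : S)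
    (hS : ∀ q ∈ φ.source, q ∈ S ↔ ∃ h, equiv (J h, 0) = φ q) :
    OpenPartialHomeomorph S H' where
  toFun q := J.symm (equiv.symm (φ q)).1
  -- Outside the target the candidate point may miss `S`; the value is then the arbitrary point `p`.
  -- On the target `hS` always selects the first branch.
  invFun h := open Classical in
    if hh : φ.symm (equiv (J h, 0)) ∈ S then ⟨_, hh⟩ else p
  source := Subtype.val ⁻¹' φ.source
  target := (fun h ↦ equiv (J h, 0)) ⁻¹' φ.target
  map_source' q hq := by
    obtain ⟨h, hh⟩ := (hS q hq).1 q.2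
    simp only [← hh, Set.mem_preimage, ContinuousLinearEquiv.symm_apply_apply, J.left_inv]
    rw [hh]
    exact φ.map_source hq
  map_target' h hh := by
    have h1 : φ.symm (equiv (J h, 0)) ∈ S :=
      (hS _ (φ.map_target hh)).2 ⟨h, (φ.right_inv hh).symm⟩
    rw [dif_pos h1]
    exact φ.map_target hh
  left_inv' q hq := by
    obtain ⟨h, hh⟩ := (hS q hq).1 q.2
    have h1 : φ.symm (φ q) = q := φ.left_inv hq
    have h2 : φ.symm (equiv (J h, 0)) ∈ S := by rw [hh, h1]; exact q.2
    have h3 : J (J.symm (equiv.symm (φ q)).1) = J h := by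
      rw [← hh, ContinuousLinearEquiv.symm_apply_apply, J.left_inv]
    have h4 : φ.symm (equiv (J (J.symm (equiv.symm (φ q)).1), 0)) ∈ S := by rwa [h3]
    rw [dif_pos h4]
    exact Subtype.ext (by simp only [h3, hh, h1])
  right_inv' h hh := by
    have h1 : φ.symm (equiv (J h, 0)) ∈ S :=
      (hS _ (φ.map_target hh)).2 ⟨h, (φ.right_inv hh).symm⟩
    rw [dif_pos h1]
    simp only [φ.right_inv hh, ContinuousLinearEquiv.symm_apply_apply, J.left_inv]
  open_source := φ.open_source.preimage continuous_subtype_val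
  open_target := φ.open_target.preimage (by fun_prop)
  continuousOn_toFun := by
    refine J.continuous_symm.comp_continuousOn
      ((continuous_fst.comp equiv.symm.continuous).comp_continuousOn
        (φ.continuousOn.comp continuous_subtype_val.continuousOn fun q hq ↦ hq))
  continuousOn_invFun := by
    rw [Topology.IsEmbedding.subtypeVal.continuousOn_iff]
    have h0 : ContinuousOn (fun h ↦ φ.symm (equiv (J h, 0)))
        ((fun h ↦ equiv (J h, 0)) ⁻¹' φ.target) :=
      φ.symm.continuousOn.comp
        (Continuous.continuousOn (f := fun h ↦ equiv (J h, (0 : F))) (by fun_prop)) fun q hq ↦ hq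
    refine h0.congr fun h hh ↦ ?_
    have h1 : φ.symm (equiv (J h, 0)) ∈ S :=
      (hS _ (φ.map_target hh)).2 ⟨h, (φ.right_inv hh).symm⟩
    simp only [Function.comp_apply]
    rw [dif_pos h1]

variable {J : ModelWithCorners ℝ E' H'} {equiv : (E' × F) ≃L[ℝ] E} {S : Set M}

theorem OpenPartialHomeomorph.slice_apply {φ : OpenPartialHomeomorph M E} {p : S}
    (hS : ∀ q ∈ φ.source, q ∈ S ↔ ∃ h, equiv (J h, 0) = φ q) (q : S) :
    φ.slice J equiv p hS q = J.symm (equiv.symm (φ q)).1 := rfl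

theorem OpenPartialHomeomorph.equiv_slice_apply {φ : OpenPartialHomeomorph M E} {p : S}
    (hS : ∀ q ∈ φ.source, q ∈ S ↔ ∃ h, equiv (J h, 0) = φ q) {q : S} (hq : (q : M) ∈ φ.source) :
    equiv (J (φ.slice J equiv p hS q), 0) = φ q := by
  obtain ⟨h, hh⟩ := (hS q hq).1 q.2
  rw [slice_apply, ← hh, ContinuousLinearEquiv.symm_apply_apply, J.left_inv]

theorem OpenPartialHomeomorph.slice_symm_apply {φ : OpenPartialHomeomorph M E} {p : S}
    (hS : ∀ q ∈ φ.source, q ∈ S ↔ ∃ h, equiv (J h, 0) = φ q) {h : H'}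
    (hh : equiv (J h, 0) ∈ φ.target) :
    ((φ.slice J equiv p hS).symm h : M) = φ.symm (equiv (J h, 0)) := by
  have h1 : φ.symm (equiv (J h, 0)) ∈ S :=
    (hS _ (φ.map_target hh)).2 ⟨h, (φ.right_inv hh).symm⟩
  exact congrArg Subtype.val (dif_pos h1)

/-- A subset of a manifold which is covered by slice charts is an embedded submanifold. -/
theorem exists_isSmoothEmbedding_of_slice [ChartedSpace E M] {n : ℕ∞ω}
    (J : ModelWithCorners ℝ E' H') (equiv : (E' × F) ≃L[ℝ] E) (φ : S → OpenPartialHomeomorph M E)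
    (hφ : ∀ p, φ p ∈ IsManifold.maximalAtlas 𝓘(ℝ, E) n M) (hp : ∀ p : S, (p : M) ∈ (φ p).source)
    (hS : ∀ p, ∀ q ∈ (φ p).source, q ∈ S ↔ ∃ h, equiv (J h, 0) = φ p q) :
    ∃ _ : ChartedSpace H' S, IsManifold J n S ∧
      Manifold.IsSmoothEmbedding J 𝓘(ℝ, E) n (Subtype.val : S → M) ∧
      ∀ p : S, equiv (extChartAt J p p, 0) = φ p p := by
  let cs : ChartedSpace H' S :=
    { atlas := Set.range fun p ↦ (φ p).slice J equiv p (hS p)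
      chartAt := fun p ↦ (φ p).slice J equiv p (hS p)
      mem_chart_source := fun p ↦ hp p
      chart_mem_atlas := fun p ↦ ⟨p, rfl⟩ }
  have hm : IsManifold J n S := by
    refine isManifold_of_contDiffOn J n S ?_
    rintro _ _ ⟨p, rfl⟩ ⟨q, rfl⟩
    have h1 : ContDiffOn ℝ n ((φ p).symm ≫ₕ φ q) ((φ p).symm ≫ₕ φ q).source := by
      have := (StructureGroupoid.compatible_of_mem_maximalAtlas (hφ p) (hφ q)).1
      simpa [contDiffPregroupoid] using this
    have h2 : ContDiff ℝ n fun x : E' ↦ equiv (x, (0 : F)) := by fun_prop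
    have h3 : ContDiff ℝ n fun x : E ↦ (equiv.symm x).1 := by fun_prop
    -- Read in the model, a transition map of slice charts is the ambient transition map restricted
    -- to the slice and projected back, hence smooth.
    have key : ∀ h, h ∈ (((φ p).slice J equiv p (hS p)).symm ≫ₕ
        (φ q).slice J equiv q (hS q)).source →
        equiv (J h, 0) ∈ ((φ p).symm ≫ₕ φ q).source ∧
        J (((φ p).slice J equiv p (hS p)).symm.trans ((φ q).slice J equiv q (hS q)) h) =
          (equiv.symm (φ q ((φ p).symm (equiv (J h, 0))))).1 := by
      intro h hh
      rw [OpenPartialHomeomorph.trans_source] at hh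
      obtain ⟨ha, hb⟩ := hh
      have ha' : equiv (J h, 0) ∈ (φ p).target := ha
      have hb' : (((φ p).slice J equiv p (hS p)).symm h : M) ∈ (φ q).source := hb
      have hc := OpenPartialHomeomorph.equiv_slice_apply (p := q) (hS q) hb'
      rw [OpenPartialHomeomorph.slice_symm_apply (hS p) ha'] at hb' hc
      refine ⟨⟨ha', hb'⟩, ?_⟩
      rw [← hc, ContinuousLinearEquiv.symm_apply_apply]
      rfl
    refine ((h3.comp_contDiffOn h1).comp h2.contDiffOn (s := _) ?_).congr ?_
    · rintro _ ⟨hx, h, rfl⟩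
      rw [Set.mem_preimage, J.left_inv] at hx
      exact (key h hx).1
    · rintro _ ⟨hx, h, rfl⟩
      rw [Set.mem_preimage, J.left_inv] at hx
      simp only [Function.comp_apply, J.left_inv]
      exact (key h hx).2
  refine ⟨cs, hm, ⟨?_, Topology.IsEmbedding.subtypeVal⟩, fun p ↦ ?_⟩
  · refine Manifold.IsImmersionOfComplement.isImmersion (F := F) fun p ↦ ?_
    -- In these two charts the inclusion is x ↦ `equiv (x, 0)`, the normal form of an immersion.
    refine Manifold.IsImmersionAtOfComplement.mk_of_charts equiv (chartAt H' p) (φ p)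
      (mem_chart_source H' p) (hp p) (IsManifold.chart_mem_maximalAtlas p) (hφ p)
      (fun q hq ↦ hq) ?_
    intro x hx
    rw [OpenPartialHomeomorph.extend_target] at hx
    obtain ⟨hx, h, rfl⟩ := hx
    rw [Set.mem_preimage, J.left_inv] at hx
    have hx' : equiv (J h, 0) ∈ (φ p).target := hx
    have h4 : ((chartAt H' p).symm h : M) = (φ p).symm (equiv (J h, 0)) :=
      OpenPartialHomeomorph.slice_symm_apply (hS p) hx'
    simp only [Function.comp_apply, OpenPartialHomeomorph.extend_coe,
      OpenPartialHomeomorph.extend_coe_symm, J.left_inv, h4]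
    exact (φ p).right_inv hx'
  · exact OpenPartialHomeomorph.equiv_slice_apply (p := p) (hS p) (hp p)

end Slice

/-! ### Charts adapted to a function -/

/-- The inverse function theorem in charts: a smooth map with invertible derivative, composed with
a chart, is a chart near the given point. -/
theorem exists_mem_maximalAtlas_of_hasFDerivAt {E M : Type*} [NormedAddCommGroup E]
    [NormedSpace ℝ E] [CompleteSpace E] [TopologicalSpace M] [ChartedSpace E M]
    [IsManifold 𝓘(ℝ, E) ∞ M] (p : M) {G : E → E} {G' : E ≃L[ℝ] E}
    (hG : ContDiffOn ℝ ∞ G (chartAt E p).target)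
    (hG' : HasFDerivAt G (G' : E →L[ℝ] E) (chartAt E p p)) :
    ∃ φ ∈ IsManifold.maximalAtlas 𝓘(ℝ, E) ∞ M, p ∈ φ.source ∧
      ∀ q ∈ φ.source, q ∈ (chartAt E p).source ∧ φ q = G (chartAt E p q) := by
  set ψ := chartAt E p
  have hp : p ∈ ψ.source := mem_chart_source E p
  have hx : ψ p ∈ ψ.target := ψ.map_source hp
  have hGx : ContDiffAt ℝ ∞ G (ψ p) := hG.contDiffAt (ψ.open_target.mem_nhds hx)
  let e := hGx.toOpenPartialHomeomorph G hG' (by simp)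
  have hcont : ContinuousAt (fderiv ℝ G) (ψ p) := hGx.continuousAt_fderiv (by simp)
  -- Smoothness of the inverse is needed on a whole neighbourhood. Invertibility of the derivative
  -- is an open condition, so the domain can be shrunk to a set `U` where it persists.
  have hunits : {L : E →L[ℝ] E | ∃ T : E ≃L[ℝ] E, (T : E →L[ℝ] E) = L} ∈ 𝓝 (fderiv ℝ G (ψ p)) := by
    rw [hG'.fderiv]
    exact ContinuousLinearEquiv.nhds G'
  obtain ⟨U, hU, hUo, hxU⟩ := mem_nhds_iff.1 (hcont hunits)
  let e' := (e.restrOpen U hUo).restrOpen ψ.target ψ.open_target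
  have hsrc : ∀ y ∈ e'.source, y ∈ U ∧ y ∈ ψ.target := by
    intro y hy
    exact ⟨hy.1.2, hy.2⟩
  have he'x : ψ p ∈ e'.source :=
    ⟨⟨hGx.mem_toOpenPartialHomeomorph_source hG' (by simp), hxU⟩, hx⟩
  have hd : ∀ y ∈ e'.source, ContDiffAt ℝ ∞ e' y := fun y hy ↦
    hG.contDiffAt (ψ.open_target.mem_nhds (hsrc y hy).2)
  have hd' : ∀ y ∈ e'.target, ContDiffAt ℝ ∞ e'.symm y := by
    intro y hy
    have h1 := e'.map_target hy
    obtain ⟨T, hT⟩ := hU (hsrc _ h1).1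
    refine e'.contDiffAt_symm (f₀' := T) hy ?_ (hd _ h1)
    rw [hT]
    exact ((hd _ h1).differentiableAt (by simp)).hasFDerivAt
  refine ⟨ψ ≫ₕ e', ?_, ⟨hp, he'x⟩, fun q hq ↦ ⟨hq.1, rfl⟩⟩
  refine OpenPartialHomeomorph.mem_maximalAtlas_of_contMDiffOn _ ?_ ?_
  · intro q hq
    exact ((hd _ hq.2).contMDiffAt.comp q ((contMDiffOn_chart q hq.1).contMDiffAt
      (ψ.open_source.mem_nhds hq.1))).contMDiffWithinAt
  · intro y hy
    rw [OpenPartialHomeomorph.trans_target] at hy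
    exact (ContMDiffAt.comp y ((contMDiffOn_chart_symm _ hy.2).contMDiffAt
      (ψ.open_target.mem_nhds hy.2)) (hd' _ hy.1).contMDiffAt).contMDiffWithinAt

/-- A function is the `0`-th coordinate of some chart near any point where its derivative does not
vanish. -/
theorem exists_chart_coord_eq {m : ℕ} [NeZero m] {M : Type*} [TopologicalSpace M]
    [ChartedSpace (EuclideanSpace ℝ (Fin m)) M] [IsManifold (𝓡 m) ∞ M] {f : M → ℝ}
    (hf : ContMDiff (𝓡 m) 𝓘(ℝ) ∞ f) (p : M) (hfp : mvfderiv (𝓡 m) f p ≠ 0) :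
    ∃ φ ∈ IsManifold.maximalAtlas (𝓡 m) ∞ M, p ∈ φ.source ∧ ∀ q ∈ φ.source, φ q 0 = f q := by
  set ψ := chartAt (EuclideanSpace ℝ (Fin m)) p
  have hx : ψ p ∈ ψ.target := ψ.map_source (mem_chart_source _ p)
  set u : EuclideanSpace ℝ (Fin m) → ℝ := f ∘ ψ.symm
  have hu : ContDiffOn ℝ ∞ u ψ.target := by
    rw [← contMDiffOn_iff_contDiffOn]
    exact hf.comp_contMDiffOn contMDiffOn_chart_symm
  have hD : fderiv ℝ u (ψ p) ≠ 0 := by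
    contrapose! hfp
    have h1 : mfderiv (𝓡 m) 𝓘(ℝ) f p = 0 := by
      rw [(hf.mdifferentiableAt (by simp)).mfderiv]
      change fderivWithin ℝ u (Set.range id) (ψ p) = 0
      rwa [Set.range_id, fderivWithin_univ]
    rw [mvfderiv, h1, ContinuousLinearMap.comp_zero]
  set D := fderiv ℝ u (ψ p)
  -- The new coordinates are x + (u x - x 0) • w. With w 0 = 1 their 0-th entry is u, and D w ≠ 0
  -- makes the derivative `L` injective. If D kills the 0-th basis vector, any v with D v ≠ 0 can be
  -- corrected along that vector to have 0-th entry 1.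
  obtain ⟨w, hw, hDw⟩ : ∃ w : EuclideanSpace ℝ (Fin m), w 0 = 1 ∧ D w ≠ 0 := by
    by_cases h0 : D (EuclideanSpace.single 0 1) = 0
    · obtain ⟨v, hv⟩ : ∃ v, D v ≠ 0 := by
        by_contra! h
        exact hD (ContinuousLinearMap.ext h)
      refine ⟨v + (1 - v 0) • EuclideanSpace.single 0 1, by simp, ?_⟩
      rwa [map_add, map_smul, h0, smul_zero, add_zero]
    · exact ⟨_, by simp, h0⟩
  let L : EuclideanSpace ℝ (Fin m) →L[ℝ] EuclideanSpace ℝ (Fin m) :=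
    ContinuousLinearMap.id ℝ _ + (D - EuclideanSpace.proj (0 : Fin m)).smulRight w
  have hL : ∀ v, L v = v + (D v - v 0) • w := fun v ↦ rfl
  have hinj : Function.Injective L := by
    refine (injective_iff_map_eq_zero L).2 fun v hv ↦ ?_
    rw [hL] at hv
    have h0 : D v = 0 := by
      have := congrArg (fun x : EuclideanSpace ℝ (Fin m) ↦ x 0) hv
      simpa [hw] using this
    have hv' : v = v 0 • w := by
      rw [h0, zero_sub, neg_smul] at hv
      exact add_neg_eq_zero.1 hv
    have h2 : v 0 = 0 := by
      rw [hv', map_smul, smul_eq_mul] at h0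
      exact (mul_eq_zero.1 h0).resolve_right hDw
    rw [hv', h2, zero_smul]
  let T := (LinearEquiv.ofInjectiveEndo L.toLinearMap hinj).toContinuousLinearEquiv
  have hT : (T : EuclideanSpace ℝ (Fin m) →L[ℝ] EuclideanSpace ℝ (Fin m)) = L := by
    ext1 v
    rfl
  have hud : HasFDerivAt u D (ψ p) :=
    ((hu.contDiffAt (ψ.open_target.mem_nhds hx)).differentiableAt (by simp)).hasFDerivAt
  obtain ⟨φ, hφ, hp, h⟩ := exists_mem_maximalAtlas_of_hasFDerivAt p (G' := T)
    (G := fun x ↦ x + (u x - EuclideanSpace.proj (𝕜 := ℝ) (0 : Fin m) x) • w)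
    (contDiffOn_id.add ((hu.sub (by fun_prop)).smul contDiffOn_const)) (by
      rw [hT]
      exact (hasFDerivAt_id _).add
        ((hud.sub (EuclideanSpace.proj (0 : Fin m)).hasFDerivAt).smul_const w))
  refine ⟨φ, hφ, hp, fun q hq ↦ ?_⟩
  obtain ⟨h1, h2⟩ := h q hq
  have h3 : u (ψ q) = f q := congrArg f (ψ.left_inv h1)
  rw [h2]
  change (ψ q + (u (ψ q) - ψ q 0) • w) 0 = f q
  simp [h3, hw]

/-- Near a point where `f` is positive there is a chart with values in the open half-space. -/
theorem exists_chart_coord_pos {m : ℕ} [NeZero m] {M : Type*} [TopologicalSpace M]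
    [ChartedSpace (EuclideanSpace ℝ (Fin m)) M] [IsManifold (𝓡 m) ∞ M] {f : M → ℝ}
    (hf : Continuous f) (p : M) (hfp : 0 < f p) :
    ∃ φ ∈ IsManifold.maximalAtlas (𝓡 m) ∞ M, p ∈ φ.source ∧
      ∀ q ∈ φ.source, 0 < φ q 0 ∧ 0 < f q := by
  -- Translation by `v` moves the 0-th coordinate of `p` to 1.
  let v := EuclideanSpace.single (0 : Fin m) (1 - chartAt (EuclideanSpace ℝ (Fin m)) p p 0)
  obtain ⟨φ, hφ, hp, h⟩ := exists_mem_maximalAtlas_of_hasFDerivAt p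
    (G := fun x ↦ x + v) (G' := ContinuousLinearEquiv.refl ℝ _) (by fun_prop)
    ((hasFDerivAt_id _).add_const v)
  let s := f ⁻¹' Set.Ioi 0 ∩ (φ.source ∩ φ ⁻¹' {x | 0 < x 0})
  have hs : IsOpen s := (isOpen_Ioi.preimage hf).inter
    (φ.isOpen_inter_preimage (isOpen_lt continuous_const (by fun_prop)))
  refine ⟨φ.restr s, restr_mem_maximalAtlas _ hφ hs, ?_, ?_⟩
  · rw [φ.restr_source' s hs]
    refine ⟨hp, hfp, hp, ?_⟩
    simp [(h p hp).2, v]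
  · rw [φ.restr_source' s hs]
    intro q hq
    exact ⟨hq.2.2.2, hq.2.1⟩

/-! ### Killing fields -/

namespace LorentzianMetric

variable {m : ℕ} {M : Type*} [TopologicalSpace M]
  [ChartedSpace (EuclideanSpace ℝ (Fin m)) M] [IsManifold (𝓡 m) ∞ M]
  (g : LorentzianMetric m M) {K K' R : Π x : M, TangentSpace (𝓡 m) x}

theorem inner_gradient (f : M → ℝ) (x : M) (w : TangentSpace (𝓡 m) x) :
    g.inner x (g.gradient f x) w = mvfderiv (𝓡 m) f x w :=
  g.inner_flat_symm x _ w

theorem IsKilling.mDiffFieldAt {g : LorentzianMetric m M} (hK : g.IsKilling K) (x : M) :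
    MDiffFieldAt K x :=
  hK.contMDiff.mdifferentiableAt (by simp)

theorem contMDiff_normSq {X : Π x : M, TangentSpace (𝓡 m) x}
    (hX : ContMDiff (𝓡 m) (𝓡 m).tangent ∞
      (fun y ↦ Bundle.TotalSpace.mk' (EuclideanSpace ℝ (Fin m)) y (X y))) :
    ContMDiff (𝓡 m) 𝓘(ℝ) ∞ (g.normSq X) := by
  intro x
  -- The function is regarded as a section of the trivial line bundle, where smoothness of bundle
  -- evaluation applies.
  have : ContMDiffAt (𝓡 m) ((𝓡 m).prod 𝓘(ℝ)) ∞
      (fun y ↦ Bundle.TotalSpace.mk' ℝ (E := Bundle.Trivial M ℝ) y (g.inner y (X y) (X y))) x := by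
    apply ContMDiffAt.clm_bundle_apply₂ (F₁ := EuclideanSpace ℝ (Fin m))
      (F₂ := EuclideanSpace ℝ (Fin m))
    · exact g.contMDiff x
    · exact hX x
    · exact hX x
  rw [Bundle.contMDiffAt_totalSpace] at this
  exact this.2

/-- Constancy of `ρ` matters: a variable coefficient would add a derivative term to the bracket. -/
theorem IsKilling.smul_add {g : LorentzianMetric m M} (hK : g.IsKilling K) (hK' : g.IsKilling K')
    (ρ : ℝ) : g.IsKilling (ρ • K + K') where
  contMDiff := (hK.contMDiff.const_smul_section).add_section hK'.contMDiff
  lieDerivative_eq_zero X Y x hX hY := by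
    have h1 := hK.lieDerivative_eq_zero X Y x hX hY
    have h2 := hK'.lieDerivative_eq_zero X Y x hX hY
    have h3 : MDiffFieldAt (ρ • K) x :=
      (hK.contMDiff.const_smul_section (a := ρ)).mdifferentiableAt (by simp)
    have h4 : ∀ Z, VectorField.mlieBracket (𝓡 m) (ρ • K + K') Z x =
        ρ • VectorField.mlieBracket (𝓡 m) K Z x + VectorField.mlieBracket (𝓡 m) K' Z x := by
      intro Z
      rw [VectorField.mlieBracket_add_left h3 (hK'.mDiffFieldAt x),
        VectorField.mlieBracket_const_smul_left (hK.mDiffFieldAt x)]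
    rw [h4, h4]
    simp only [Pi.add_apply, Pi.smul_apply, map_add, map_smul, add_apply, smul_apply, smul_eq_mul]
    linear_combination ρ * h1 + h2

/-- The Killing equation: the covariant derivative of a Killing field is skew. -/
theorem IsKilling.inner_leviCivita_add {g : LorentzianMetric m M} (hR : g.IsKilling R) (x : M)
    (v w : TangentSpace (𝓡 m) x) :
    g.inner x (g.leviCivita R x v) w + g.inner x v (g.leviCivita R x w) = 0 := by
  obtain ⟨X, hX, rfl⟩ : ∃ X : Π x : M, TangentSpace (𝓡 m) x, MDiffFieldAt X x ∧ X x = v :=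
    ⟨FiberBundle.extend (EuclideanSpace ℝ (Fin m)) v,
      FiberBundle.mdifferentiableAt_extend .., FiberBundle.extend_apply_self ..⟩
  obtain ⟨Y, hY, rfl⟩ : ∃ Y : Π x : M, TangentSpace (𝓡 m) x, MDiffFieldAt Y x ∧ Y x = w :=
    ⟨FiberBundle.extend (EuclideanSpace ℝ (Fin m)) w,
      FiberBundle.mdifferentiableAt_extend .., FiberBundle.extend_apply_self ..⟩
  have hR' := hR.mDiffFieldAt x
  have h1 := hR.lieDerivative_eq_zero X Y x hX hY
  have h2 := g.isLeviCivita_leviCivita.metric_compatible X Y x (R x) hX hY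
  -- Torsion-freeness gives [R, X] = ∇_X-free part ∇_R X minus ∇_X R; the ∇_R terms cancel against
  -- those from metric compatibility.
  rw [← g.isLeviCivita_leviCivita.torsion_free R X x hR' hX,
    ← g.isLeviCivita_leviCivita.torsion_free R Y x hR' hY, h2] at h1
  simp only [map_sub, sub_apply] at h1
  linear_combination h1

/-- Metric compatibility gives 2⟨R, ∇_w R⟩, and skewness of ∇R exchanges R and w at the cost of a
sign. -/
theorem IsKilling.mvfderiv_normSq {g : LorentzianMetric m M} (hR : g.IsKilling R) (x : M)
    (w : TangentSpace (𝓡 m) x) :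
    mvfderiv (𝓡 m) (g.normSq R) x w = -2 * g.inner x (g.selfDeriv R x) w := by
  have h1 := g.isLeviCivita_leviCivita.metric_compatible R R x w (hR.mDiffFieldAt x)
    (hR.mDiffFieldAt x)
  have h2 := hR.inner_leviCivita_add x (R x) w
  have h3 := g.symm x (R x) (g.leviCivita R x w)
  change mvfderiv (𝓡 m) (g.normSq R) x w = _ at h1
  rw [h1, selfDeriv]
  linear_combination 2 * h2 - h3

theorem IsKilling.gradient_normSq {g : LorentzianMetric m M} (hR : g.IsKilling R) (x : M) :
    g.gradient (g.normSq R) x = (-2 : ℝ) • g.selfDeriv R x := by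
  refine sub_eq_zero.1 (g.eq_zero_of_inner_eq_zero fun w ↦ ?_)
  rw [map_sub, sub_apply, g.inner_gradient, hR.mvfderiv_normSq]
  simp

theorem IsKilling.inner_selfDeriv_self {g : LorentzianMetric m M} (hR : g.IsKilling R) (x : M) :
    g.inner x (g.selfDeriv R x) (R x) = 0 := by
  have h1 := hR.inner_leviCivita_add x (R x) (R x)
  rw [g.symm x (R x)] at h1
  rw [selfDeriv]
  linarith

/-- `∇_R R` is orthogonal to all Killing fields commuting with the Killing field `R`. -/
theorem IsKilling.inner_selfDeriv_of_mlieBracket_eq_zero {g : LorentzianMetric m M}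
    (hR : g.IsKilling R) (hK : g.IsKilling K) {x : M}
    (h : VectorField.mlieBracket (𝓡 m) K R x = 0) :
    g.inner x (g.selfDeriv R x) (K x) = 0 := by
  -- Both bracket terms of (L_K g)(R, R) vanish, leaving K⟨R, R⟩ = 0.
  have h1 := hK.lieDerivative_eq_zero R R x (hR.mDiffFieldAt x) (hR.mDiffFieldAt x)
  have h2 := hR.mvfderiv_normSq x (K x)
  change mvfderiv (𝓡 m) (g.normSq R) x (K x) - _ - _ = 0 at h1
  simp only [h, map_zero, zero_apply, sub_zero] at h1
  linarith

/-! ### Lorentzian linear algebra -/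

/-- The orthogonal complement of a timelike vector is spacelike. -/
theorem inner_self_pos_of_inner_eq_zero {x : M} {t v : TangentSpace (𝓡 m) x}
    (ht : g.inner x t t < 0) (htv : g.inner x t v = 0) (hv : v ≠ 0) : 0 < g.inner x v v := by
  obtain ⟨u, -, hu⟩ := g.lorentzian x
  have htv' : g.inner x v t = 0 := by rw [g.symm, htv]
  have hut : g.inner x u t ≠ 0 := fun h ↦
    (hu t h (by rintro rfl; simp at ht)).not_gt ht
  set a := g.inner x u v
  set b := g.inner x u t
  -- This combination is orthogonal to `u`, hence spacelike. As t ⊥ v, its square is a²⟨t, t⟩ +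
  -- b²⟨v, v⟩, whose first term is nonpositive, so ⟨v, v⟩ > 0.
  have hw : g.inner x u (a • t - b • v) = 0 := by
    simp only [map_sub, map_smul, smul_eq_mul]
    exact sub_eq_zero.2 (mul_comm _ _)
  have hne : a • t - b • v ≠ 0 := by
    intro h
    have h1 : g.inner x t (a • t - b • v) = 0 := by rw [h, map_zero]
    simp only [map_sub, map_smul, smul_eq_mul, htv, mul_zero, sub_zero] at h1
    have ha : a = 0 := (mul_eq_zero.1 h1).resolve_right ht.ne
    rw [ha, zero_smul, zero_sub, neg_eq_zero] at h
    exact (smul_eq_zero.1 h).elim hut hv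
  have h2 := hu _ hw hne
  simp only [map_sub, map_smul, sub_apply, smul_apply, smul_eq_mul, htv, htv', mul_zero, sub_zero,
    zero_sub] at h2
  by_contra! h3
  nlinarith [mul_nonneg (sq_nonneg a) (neg_nonneg.2 ht.le), mul_nonneg (sq_nonneg b)
    (neg_nonneg.2 h3)]

/-- A vector orthogonal to a Lorentzian plane is spacelike. -/
theorem inner_self_pos_of_inner_eq_zero_of_det_neg {x : M} {k l v : TangentSpace (𝓡 m) x}
    (hdet : g.inner x k k * g.inner x l l - g.inner x k l * g.inner x l k < 0)
    (hk : g.inner x v k = 0) (hl : g.inner x v l = 0) (hv : v ≠ 0) : 0 < g.inner x v v := by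
  obtain ⟨a, b, hab⟩ : ∃ a b : ℝ, g.inner x (a • k + b • l) (a • k + b • l) < 0 := by
    have hs := g.symm x l k
    have hexp : ∀ a b : ℝ, g.inner x (a • k + b • l) (a • k + b • l) =
        a ^ 2 * g.inner x k k + 2 * a * b * g.inner x k l + b ^ 2 * g.inner x l l := by
      intro a b
      simp only [map_add, map_smul, add_apply, smul_apply, smul_eq_mul, hs]
      ring
    simp only [hexp]
    rw [hs] at hdet
    generalize g.inner x k k = A at *
    generalize g.inner x k l = B at *
    generalize g.inner x l l = C at *
    -- A timelike vector of the plane: k itself if A < 0; if A = 0, a multiple of k is added to l to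
    -- give the form the value -1; if A > 0, the vector -B k + A l has value A(AC - B²) < 0.
    rcases lt_trichotomy A 0 with hA | rfl | hA
    · exact ⟨1, 0, by simpa using hA⟩
    · have hB : B ≠ 0 := by rintro rfl; simp at hdet
      refine ⟨-(C + 1) / (2 * B), 1, ?_⟩
      have : 2 * (-(C + 1) / (2 * B)) * 1 * B = -(C + 1) := by field_simp
      rw [this]
      linarith
    · exact ⟨-B, A, by nlinarith⟩
  refine g.inner_self_pos_of_inner_eq_zero hab ?_ hv
  rw [g.symm]
  simp [hk, hl]

end LorentzianMetric

/-! ### Outward vectors and regular level sets -/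

/-- A vector along which a function vanishing at `p` strictly decreases points out of its
nonnegativity set. -/
theorem isOutwardPointing_of_mvfderiv_neg {m : ℕ} {M : Type*} [TopologicalSpace M]
    [ChartedSpace (EuclideanSpace ℝ (Fin m)) M] {f : M → ℝ} {p : M} {v : TangentSpace (𝓡 m) p}
    (hf : MDifferentiableAt (𝓡 m) 𝓘(ℝ) f p) (hp : f p = 0) (hv : mvfderiv (𝓡 m) f p v < 0) :
    IsOutwardPointing {x | 0 ≤ f x} p v := by
  rintro c rfl hc
  have h1 : HasFDerivAt (f ∘ c) ((1 : ℝ →L[ℝ] ℝ).smulRight (mvfderiv (𝓡 m) f (c 0) v)) 0 := by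
    refine (hf.hasMFDerivAt.comp (0 : ℝ) hc).hasFDerivAt.congr_fderiv
      (ContinuousLinearMap.ext fun t ↦ ?_)
    exact map_smul (mvfderiv (𝓡 m) f (c 0)) (show ℝ from t) v
  have h2 : HasDerivAt (f ∘ c) (mvfderiv (𝓡 m) f (c 0) v) 0 := by
    simpa using h1.hasDerivAt
  -- The difference quotient f(c t)/t is negative for small t ≠ 0, so f(c t) and t have opposite
  -- signs.
  have h3 := (hasDerivAt_iff_tendsto_slope.1 h2).eventually (gt_mem_nhds hv)
  rw [eventually_nhdsWithin_iff] at h3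
  constructor <;> rw [eventually_nhdsWithin_iff] <;> filter_upwards [h3] with t ht ht0
  · have := ht (ne_of_lt ht0)
    rw [slope_def_field, Function.comp_apply, Function.comp_apply, hp, sub_zero, sub_zero] at this
    have ht0' : t < 0 := ht0
    by_contra hneg
    have : f (c t) < 0 := not_le.1 hneg
    have := div_pos_of_neg_of_neg this ht0'
    linarith
  · have := ht (ne_of_gt ht0)
    rw [slope_def_field, Function.comp_apply, Function.comp_apply, hp, sub_zero, sub_zero] at this
    have ht0' : 0 < t := ht0
    intro hpos
    have := div_nonneg (show 0 ≤ f (c t) from hpos) ht0'.le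
    linarith

/-- Splitting off the `0`-th coordinate of Euclidean space. -/
theorem exists_continuousLinearEquiv_coord_zero (m : ℕ) [NeZero m] :
    ∃ e : (EuclideanSpace ℝ (Fin (m - 1)) × ℝ) ≃L[ℝ] EuclideanSpace ℝ (Fin m),
      ∀ y t, e (y, t) 0 = t := by
  obtain ⟨k, rfl⟩ := Nat.exists_eq_succ_of_ne_zero (NeZero.ne m)
  let e : (EuclideanSpace ℝ (Fin k) × ℝ) ≃ₗ[ℝ] EuclideanSpace ℝ (Fin (k + 1)) :=
    { toFun := fun z ↦ WithLp.toLp 2 (Fin.cons z.2 z.1)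
      map_add' := fun a b ↦ by
        ext i
        refine Fin.cases ?_ (fun i ↦ ?_) i <;> simp
      map_smul' := fun c a ↦ by
        ext i
        refine Fin.cases ?_ (fun i ↦ ?_) i <;> simp
      invFun := fun x ↦ (WithLp.toLp 2 fun i ↦ x i.succ, x 0)
      left_inv := fun a ↦ by
        refine Prod.ext ?_ ?_
        · ext i
          simp
        · simp
      right_inv := fun x ↦ by
        ext i
        refine Fin.cases ?_ (fun i ↦ ?_) i <;> simp }
  exact ⟨e.toContinuousLinearEquiv, fun y t ↦ rfl⟩

section

variable {m : ℕ} [NeZero m] {M : Type*} [TopologicalSpace M]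
  [ChartedSpace (EuclideanSpace ℝ (Fin m)) M] [IsManifold (𝓡 m) ∞ M] {f : M → ℝ}

/-- A regular superlevel set is an embedded submanifold with boundary. -/
theorem exists_isSmoothEmbedding_nonneg (hf : ContMDiff (𝓡 m) 𝓘(ℝ) ∞ f)
    (hreg : ∀ p, f p = 0 → mvfderiv (𝓡 m) f p ≠ 0) :
    ∃ _ : ChartedSpace (EuclideanHalfSpace m) {x | 0 ≤ f x},
      IsManifold (𝓡∂ m) ∞ {x | 0 ≤ f x} ∧
      Manifold.IsSmoothEmbedding (𝓡∂ m) (𝓡 m) ∞ (Subtype.val : {x | 0 ≤ f x} → M) ∧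
      Subtype.val '' (𝓡∂ m).interior {x | 0 ≤ f x} = {p : M | 0 < f p} ∧
      Subtype.val '' (𝓡∂ m).boundary {x | 0 ≤ f x} = {p : M | f p = 0} := by
  -- Only the sign of the 0-th coordinate has to agree with that of `f`. At a zero the coordinate is
  -- `f`; elsewhere any chart translated into the open half-space serves.
  have hchart : ∀ p : {x | 0 ≤ f x}, ∃ φ ∈ IsManifold.maximalAtlas (𝓡 m) ∞ M, (p : M) ∈ φ.source ∧
      ∀ q ∈ φ.source, (0 ≤ f q ↔ 0 ≤ φ q 0) ∧ (0 < f q ↔ 0 < φ q 0) := by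
    intro p
    have h0 : 0 ≤ f p := p.2
    rcases h0.eq_or_lt with h | h
    · obtain ⟨φ, hφ, hp, h1⟩ := exists_chart_coord_eq hf (p : M) (hreg p h.symm)
      exact ⟨φ, hφ, hp, fun q hq ↦ by rw [h1 q hq]; exact ⟨Iff.rfl, Iff.rfl⟩⟩
    · obtain ⟨φ, hφ, hp, h1⟩ := exists_chart_coord_pos (m := m) hf.continuous (p : M) h
      exact ⟨φ, hφ, hp, fun q hq ↦
        ⟨iff_of_true (h1 q hq).2.le (h1 q hq).1.le, iff_of_true (h1 q hq).2 (h1 q hq).1⟩⟩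
  choose φ hφ hp h using hchart
  -- The codimension is zero, so the complementary factor is the trivial space `PUnit`.
  obtain ⟨cs, h1, h2, h3⟩ := exists_isSmoothEmbedding_of_slice (n := ∞) (𝓡∂ m)
    (ContinuousLinearEquiv.prodUnique ℝ (EuclideanSpace ℝ (Fin m)) PUnit) φ hφ hp (by
      intro p q hq
      constructor
      · exact fun hqS ↦ ⟨⟨φ p q, (h p q hq).1.1 hqS⟩, rfl⟩
      · rintro ⟨y, hy⟩
        refine (h p q hq).1.2 ?_
        rw [← hy]
        exact y.2)
  have h3' : ∀ p, extChartAt (𝓡∂ m) p p = φ p p := h3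
  have hint : ∀ p : {x | 0 ≤ f x}, (𝓡∂ m).IsInteriorPoint p ↔ 0 < f p := by
    intro p
    rw [ModelWithCorners.IsInteriorPoint, h3', interior_range_modelWithCornersEuclideanHalfSpace,
      (h p p (hp p)).2]
    rfl
  refine ⟨cs, h1, h2, ?_, ?_⟩
  · ext x
    constructor
    · rintro ⟨p, hpi, rfl⟩
      exact (hint p).1 hpi
    · exact fun hx ↦ ⟨⟨x, (show 0 < f x from hx).le⟩, (hint _).2 hx, rfl⟩
  · rw [← ModelWithCorners.compl_interior]
    ext x
    constructor
    · rintro ⟨p, hpi, rfl⟩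
      exact ((show 0 ≤ f p from p.2).antisymm (not_lt.1 fun hlt ↦ hpi ((hint p).2 hlt))).symm
    · intro hx
      have hx' : f x = 0 := hx
      exact ⟨⟨x, hx'.ge⟩, fun hi ↦ ((hint _).1 hi).ne' hx', rfl⟩

/-- A regular level set is an embedded submanifold, on whose tangent spaces `df` vanishes. -/
theorem exists_isSmoothEmbedding_eq_zero (hf : ContMDiff (𝓡 m) 𝓘(ℝ) ∞ f)
    (hreg : ∀ p, f p = 0 → mvfderiv (𝓡 m) f p ≠ 0) :
    ∃ _ : ChartedSpace (EuclideanSpace ℝ (Fin (m - 1))) {x | f x = 0},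
      IsManifold (𝓡 (m - 1)) ∞ {x | f x = 0} ∧
      Manifold.IsSmoothEmbedding (𝓡 (m - 1)) (𝓡 m) ∞ (Subtype.val : {x | f x = 0} → M) ∧
      ∀ (p : {x | f x = 0}) (w : TangentSpace (𝓡 (m - 1)) p),
        mvfderiv (𝓡 m) f p
          (mfderiv (𝓡 (m - 1)) (𝓡 m) (Subtype.val : {x | f x = 0} → M) p w) = 0 := by
  have hchart : ∀ p : {x | f x = 0}, ∃ φ ∈ IsManifold.maximalAtlas (𝓡 m) ∞ M, (p : M) ∈ φ.source ∧
      ∀ q ∈ φ.source, φ q 0 = f q := fun p ↦ exists_chart_coord_eq hf p (hreg p p.2)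
  choose φ hφ hp h using hchart
  obtain ⟨e, he⟩ := exists_continuousLinearEquiv_coord_zero m
  obtain ⟨cs, h1, h2, -⟩ := exists_isSmoothEmbedding_of_slice (n := ∞) (𝓡 (m - 1)) e φ hφ hp (by
    intro p q hq
    constructor
    · intro hqS
      refine ⟨(e.symm (φ p q)).1, ?_⟩
      have h0 : (e.symm (φ p q)).2 = 0 := by
        rw [← he (e.symm (φ p q)).1 (e.symm (φ p q)).2, Prod.mk.eta, e.apply_symm_apply, h p q hq]
        exact hqS
      change e ((e.symm (φ p q)).1, 0) = φ p q
      rw [← h0, Prod.mk.eta, e.apply_symm_apply]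
    · rintro ⟨y, hy⟩
      change f q = 0
      rw [← h p q hq, ← hy, he])
  refine ⟨cs, h1, h2, fun p w ↦ ?_⟩
  have h4 : mfderiv (𝓡 (m - 1)) 𝓘(ℝ) (f ∘ (Subtype.val : {x | f x = 0} → M)) p =
      (mfderiv (𝓡 m) 𝓘(ℝ) f p).comp
        (mfderiv (𝓡 (m - 1)) (𝓡 m) (Subtype.val : {x | f x = 0} → M) p) :=
    mfderiv_comp p (hf.mdifferentiableAt (by simp)) (h2.contMDiff.mdifferentiableAt (by simp))
  -- Since `f` is constant on its zero set, the chain rule makes df vanish on the image of the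
  -- tangent space.
  have h5 : f ∘ (Subtype.val : {x | f x = 0} → M) = fun _ ↦ 0 := funext fun x ↦ x.2
  rw [h5, mfderiv_const] at h4
  exact (DFunLike.congr_fun h4 w).symm

end

/-! ### The main theorem -/

theorem proposition2 {m : ℕ} [NeZero m] {M : Type*} [TopologicalSpace M] [T2Space M]
    [SecondCountableTopology M] [ChartedSpace (EuclideanSpace ℝ (Fin m)) M]
    [IsManifold (𝓡 m) ∞ M] (g : LorentzianMetric m M)
    (Kt Kφ : Π x : M, TangentSpace (𝓡 m) x) (hKt : g.IsKilling Kt) (hKφ : g.IsKilling Kφ)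
    (hcomm : ∀ x, VectorField.mlieBracket (𝓡 m) Kt Kφ x = 0)
    (hdet : ∀ x, Matrix.det !![g.inner x (Kt x) (Kt x), g.inner x (Kt x) (Kφ x);
      g.inner x (Kφ x) (Kt x), g.inner x (Kφ x) (Kφ x)] < 0)
    (ρ : ℝ) (R : Π x : M, TangentSpace (𝓡 m) x) (hR : R = impactField ρ Kt Kφ)
    (hnull : ∀ x, g.normSq R x = 0 → g.selfDeriv R x ≠ 0) :
    -- the function `⟨R, R⟩` is smooth, with gradient `-2 ∇_R R`, and `∇_R R` is orthogonal to `R`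
    ContMDiff (𝓡 m) 𝓘(ℝ) ∞ (g.normSq R) ∧
    (∀ x, g.gradient (g.normSq R) x = (-2 : ℝ) • g.selfDeriv R x) ∧
    (∀ x, g.inner x (g.selfDeriv R x) (R x) = 0) ∧
    -- `{⟨R, R⟩ ≥ 0}` is an `m`-dimensional embedded submanifold with boundary
    (∃ _ : ChartedSpace (EuclideanHalfSpace m) (g.region R),
      IsManifold (𝓡∂ m) ∞ (g.region R) ∧
      Manifold.IsSmoothEmbedding (𝓡∂ m) (𝓡 m) ∞ (Subtype.val : g.region R → M) ∧
      Subtype.val '' (𝓡∂ m).interior (g.region R) = {p : M | 0 < g.normSq R p} ∧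
      Subtype.val '' (𝓡∂ m).boundary (g.region R) = {p : M | g.normSq R p = 0}) ∧
    -- its boundary is an `(m - 1)`-dimensional embedded submanifold, to which `∇_R R` is normal
    (∃ _ : ChartedSpace (EuclideanSpace ℝ (Fin (m - 1))) (g.nullSet R),
      IsManifold (𝓡 (m - 1)) ∞ (g.nullSet R) ∧
      Manifold.IsSmoothEmbedding (𝓡 (m - 1)) (𝓡 m) ∞ (Subtype.val : g.nullSet R → M) ∧
      ∀ (p : g.nullSet R) (w : TangentSpace (𝓡 (m - 1)) p),
        g.inner p (g.selfDeriv R p)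
          (mfderiv (𝓡 (m - 1)) (𝓡 m) (Subtype.val : g.nullSet R → M) p w) = 0) ∧
    -- on the boundary, `∇_R R` points outwards, and `⟨R, R⟩` decreases along it
    (∀ p ∈ g.nullSet R, IsOutwardPointing (g.region R) p (g.selfDeriv R p) ∧
      mvfderiv (𝓡 m) (g.normSq R) p (g.selfDeriv R p) < 0) := by
  have hKR : g.IsKilling R := by
    rw [hR]
    exact hKt.smul_add hKφ ρ
  have hf := g.contMDiff_normSq hKR.contMDiff
  have hperp := hKR.inner_selfDeriv_self
  -- Commutation passes to R: [K_t, R] = ρ[K_t, K_t] + [K_t, K_φ] = 0.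
  have hperp_t : ∀ x, g.inner x (g.selfDeriv R x) (Kt x) = 0 := by
    intro x
    refine hKR.inner_selfDeriv_of_mlieBracket_eq_zero hKt ?_
    have h1 : MDiffFieldAt (ρ • Kt) x :=
      (hKt.contMDiff.const_smul_section (a := ρ)).mdifferentiableAt (by simp)
    change VectorField.mlieBracket (𝓡 m) Kt R x = 0
    rw [hR]
    change VectorField.mlieBracket (𝓡 m) Kt (ρ • Kt + Kφ) x = 0
    rw [VectorField.mlieBracket_add_right h1 (hKφ.mDiffFieldAt x),
      VectorField.mlieBracket_const_smul_right (hKt.mDiffFieldAt x), hcomm]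
    simp
  have hperp_φ : ∀ x, g.inner x (g.selfDeriv R x) (Kφ x) = 0 := by
    intro x
    have h1 := hperp x
    have h2 : R x = ρ • Kt x + Kφ x := by rw [hR, impactField]
    rw [h2, map_add, map_smul, hperp_t, smul_zero, zero_add] at h1
    exact h1
  -- The decisive sign: ∇_R R is a nonzero vector orthogonal to a Lorentzian plane.
  have hpos : ∀ x, g.normSq R x = 0 → 0 < g.inner x (g.selfDeriv R x) (g.selfDeriv R x) := by
    intro x hx
    refine g.inner_self_pos_of_inner_eq_zero_of_det_neg ?_ (hperp_t x) (hperp_φ x) (hnull x hx)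
    simpa [Matrix.det_fin_two] using hdet x
  have hneg : ∀ x, g.normSq R x = 0 →
      mvfderiv (𝓡 m) (g.normSq R) x (g.selfDeriv R x) < 0 := by
    intro x hx
    rw [hKR.mvfderiv_normSq]
    linarith [hpos x hx]
  have hreg : ∀ x, g.normSq R x = 0 → mvfderiv (𝓡 m) (g.normSq R) x ≠ 0 := by
    intro x hx h0
    have := hneg x hx
    rw [h0] at this
    exact lt_irrefl _ this
  refine ⟨hf, hKR.gradient_normSq, hperp, exists_isSmoothEmbedding_nonneg hf hreg, ?_,
    fun p hp ↦ ⟨isOutwardPointing_of_mvfderiv_neg (hf.mdifferentiableAt (by simp)) hp (hneg p hp),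
      hneg p hp⟩⟩
  obtain ⟨cs, h1, h2, h3⟩ := exists_isSmoothEmbedding_eq_zero hf hreg
  refine ⟨cs, h1, h2, fun p w ↦ ?_⟩
  have h4 := h3 p w
  rw [hKR.mvfderiv_normSq] at h4
  exact (mul_eq_zero.1 h4).resolve_left (by norm_num)
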